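/- Let $n\ge 1$ and let $L$ be an $n\times n$ matrix with non-negative integer entries and zero diagonal. An arithmetical structure on $L$ is a pair $(\mathbf d,\mathbf r)$ of vectors of positive integers with $(\mathrm{Diag}(\mathbf d)-L)\mathbf r^t=\mathbf 0^t$ and $\gcd(r_1,\dots,r_n)=1$; $\mathcal A(L)$ is the set of these pairs and $\mathcal D(L)=\{\mathbf d : (\mathbf d,\mathbf r)\in\mathcal A(L)\text{ for some }\mathbf r\}$ is the set of $d$-arithmetical structures. Call $L$ reducible if for some permutation matrix $P$ one has $P^tLP=\begin{pmatrix}X&Y\\0&Z\end{pmatrix}$ with $X,Z$ square and non-empty, and irreducible otherwise. An almost non-singular $M$-matrix is a square matrix with non-positive off-diagonal entries, non-negative determinant and positive proper principal minors. Let $\mathcal D_{\ge 0}(L)$ be the set of vectors $\mathbf d$ of positive integers such that $\mathrm{Diag}(\mathbf d)-L$ is an almost non-singular $M$-matrix, and let $\min\mathcal D_{\ge 0}(L)$ be the set of its minimal elements for the componentwise order. The following algorithm $\mathrm{Min}$ takes $L$ as input. For $n=1$ it returns $\{(1)\}$. For $n=2$, with $L=\begin{pmatrix}0&a\\b&0\end{pmatrix}$,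 it returns the minimal elements of $\{(d,\max(1,\lceil ab/d\rceil)) : 1\le d\le\max(1,ab)\}$. For $n\ge 3$: (1) for every $s$ it runs $\mathrm{Min}$ on the matrix $L_s$ obtained from $L$ by deleting the $s$-th row and column, and inserts in each vector obtained a new $s$-th entry equal to $1$, which gives a finite set $A_s$; (2) for every choice of one vector from each $A_s$ it forms the componentwise maximum $\mathbf d$ of the $n$ vectors chosen; (3) for each such $\mathbf d$, let $S(\mathbf d)$ be the set of $s$ such that the coefficient of $x_s$ in $\det(\mathrm{Diag}(X+\mathbf d)-L)$ is $0$, and let $\mathbf e_t$ be the $t$-th unit vector; if $S(\mathbf d)=\emptyset$ it keeps $\mathbf d$; if $|S(\mathbf d)|=1$ it replaces $\mathbf d$ by the vectors $\mathbf d+\mathbf e_t$ with $t\notin S(\mathbf d)$; if $|S(\mathbf d)|\ge 2$ it replaces $\mathbf d$ by the vectors $\mathbf d+\mathbf e_t$ with $t\notin S(\mathbf d)$ and the vectors $\mathbf d+\mathbf e_s+\mathbf e_t$ with $s\in S(\mathbf d)$ and $t\notin S(\mathbf d+\mathbf e_s)$; (4) for each vector $\mathbf d$ so obtained it finds, by search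 in the box $\{0,\dots,\max(0,-\det(\mathrm{Diag}(\mathbf d)-L))\}^n$, the minimal $\mathbf x$ with $\det(\mathrm{Diag}(\mathbf d+\mathbf x)-L)\ge 0$, and collects the vectors $\mathbf d+\mathbf x$; (5) it returns the minimal ones among all the vectors collected. Algorithm AA: if $L$ is irreducible, return the set of those $\mathbf d$ in the output of $\mathrm{Min}$ on $L$ for which $\det(\mathrm{Diag}(\mathbf d)-L)=0$; otherwise, if $L$ has a zero row, return $\emptyset$; otherwise report that there are infinitely many arithmetical structures. Then these algorithms are correct: $\mathrm{Min}$ returns $\min\mathcal D_{\ge 0}(L)$, and (i) if $L$ is irreducible, Algorithm AA returns $\mathcal D(L)$, one has $\mathcal D(L)=\{\mathbf d\in\min\mathcal D_{\ge0}(L) : \det(\mathrm{Diag}(\mathbf d)-L)=0\}$, and every $\mathbf d\in\mathcal D(L)$ belongs to exactly one arithmetical structure $(\mathbf d,\mathbf r)$; (ii) if $L$ has a zero row, Algorithm AA returns $\emptyset$, and $\mathcal D(L)=\mathcal A(L)=\emptyset$; (iii) if $L$ is reducible and has no zero row, Algorithm AA reports infinitely many structures, and the set $\mathcal A(L)$ is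 infinite. -/

import Mathlib

namespace ArithStruct

/-! ### Arithmetical structures -/

/-- The integer matrix `Diag(d) - L`. -/
def diagSub {n : ℕ} (L : Matrix (Fin n) (Fin n) ℕ) (d : Fin n → ℕ) : Matrix (Fin n) (Fin n) ℤ :=
  Matrix.diagonal (fun i => (d i : ℤ)) - L.map (fun a => (a : ℤ))

/-- The arithmetical structures `(d, r)` on `L`. -/
def structures {n : ℕ} (L : Matrix (Fin n) (Fin n) ℕ) : Set ((Fin n → ℕ) × (Fin n → ℕ)) :=
  {p | (∀ i, 0 < p.1 i) ∧ (∀ i, 0 < p.2 i) ∧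
    (diagSub L p.1).mulVec (fun i => (p.2 i : ℤ)) = 0 ∧ Finset.univ.gcd p.2 = 1}

/-- The `d`-arithmetical structures on `L`. -/
def dStructures {n : ℕ} (L : Matrix (Fin n) (Fin n) ℕ) : Set (Fin n → ℕ) :=
  {d | ∃ r, (d, r) ∈ structures L}

/-! ### Irreducibility and M-matrices -/

/-- `L` is reducible: simultaneously permuting rows and columns by some `σ` yields a matrix whose
lower left block (rows `≥ k`, columns `< k`) vanishes, both diagonal blocks being non-empty. -/
def IsReducible {n : ℕ} (L : Matrix (Fin n) (Fin n) ℕ) : Prop :=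
  ∃ k : Fin n, 0 < k.val ∧ ∃ σ : Equiv.Perm (Fin n),
    ∀ i j : Fin n, k ≤ i → j < k → L (σ i) (σ j) = 0

instance {n : ℕ} (L : Matrix (Fin n) (Fin n) ℕ) : Decidable (IsReducible L) := by
  unfold IsReducible; infer_instance

/-- `L` has a row equal to zero. -/
def HasZeroRow {n : ℕ} (L : Matrix (Fin n) (Fin n) ℕ) : Prop :=
  ∃ i, ∀ j, L i j = 0

instance {n : ℕ} (L : Matrix (Fin n) (Fin n) ℕ) : Decidable (HasZeroRow L) :=
  @Fintype.decidableExistsFintype (Fin n) (fun i => ∀ j, L i j = 0)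
    (fun i => @Nat.decidableForallFin n (fun j => L i j = 0) (fun j => Nat.decEq (L i j) 0)) _

/-- The principal minor of `M` with rows and columns in `I`. -/
def principalMinor {n : ℕ} (M : Matrix (Fin n) (Fin n) ℤ) (I : Finset (Fin n)) : ℤ :=
  (M.submatrix (fun i : {x // x ∈ I} => i.val) (fun i : {x // x ∈ I} => i.val)).det

/-- A Z-matrix has non-positive off-diagonal entries. -/
def IsZMatrix {n : ℕ} (M : Matrix (Fin n) (Fin n) ℤ) : Prop :=
  ∀ i j, i ≠ j → M i j ≤ 0

/-- An M-matrix is a Z-matrix all of whose principal minors are non-negative. -/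
def IsMMatrix {n : ℕ} (M : Matrix (Fin n) (Fin n) ℤ) : Prop :=
  IsZMatrix M ∧ ∀ I, 0 ≤ principalMinor M I

/-- An M-matrix is almost non-singular if all its proper principal minors are positive. -/
def IsAlmostNonsingMMatrix {n : ℕ} (M : Matrix (Fin n) (Fin n) ℤ) : Prop :=
  IsMMatrix M ∧ ∀ I, I ≠ Finset.univ → 0 < principalMinor M I

/-- `D_{≥0}(L)`: the positive vectors `d` with `Diag(d) - L` an almost non-singular M-matrix. -/
def dGeZero {n : ℕ} (L : Matrix (Fin n) (Fin n) ℕ) : Set (Fin n → ℕ) :=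
  {d | (∀ i, 0 < d i) ∧ IsAlmostNonsingMMatrix (diagSub L d)}

/-- `min D_{≥0}(L)`: the minimal elements for the componentwise order. -/
def minDGeZero {n : ℕ} (L : Matrix (Fin n) (Fin n) ℕ) : Set (Fin n → ℕ) :=
  {d | Minimal (fun x => x ∈ dGeZero L) d}

/-! ### The algorithm computing `min D_{≥0}(L)`

All functions below are executable. -/

/-- The minimal elements of a finite set of vectors. -/
def minimals {n : ℕ} (A : Finset (Fin n → ℕ)) : Finset (Fin n → ℕ) :=
  A.filter (fun x => ∀ y ∈ A, (∀ i, y i ≤ x i) → y = x)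

/-- Increase the `s`-th entry of `d` by one. -/
def bump {n : ℕ} (d : Fin n → ℕ) (s : Fin n) : Fin n → ℕ :=
  Function.update d s (d s + 1)

/-- The set `S` of indices `s` such that the coefficient of `x_s` in
`det(Diag(X + d) - L)` is zero; that coefficient is the minor of `Diag(d) - L` in which the `s`-th
row and column are deleted. -/
def zeroCoefs {n : ℕ} (L : Matrix (Fin n) (Fin n) ℕ) (d : Fin n → ℕ) : Finset (Fin n) :=
  Finset.univ.filter (fun s => principalMinor (diagSub L d) (Finset.univ.erase s) = 0)

/-- The call of `Find` with `k = 1`: increase an entry outside `S`. -/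
def findOne {n : ℕ} (L : Matrix (Fin n) (Fin n) ℕ) (d : Fin n → ℕ) : Finset (Fin n → ℕ) :=
  (zeroCoefs L d)ᶜ.image (bump d)

/-- The procedure `Find`, with `k = |S|`: vectors above `d`, including all minimal ones, at which
all the proper principal minors are positive.  If `k = 0` keep `d`; if `k = 1` increase an entry
outside `S`; otherwise increase an entry outside `S`, or increase an entry in `S` and call `Find`
with `k = 1` on the result. -/
def find {n : ℕ} (L : Matrix (Fin n) (Fin n) ℕ) (d : Fin n → ℕ) : Finset (Fin n → ℕ) :=
  if (zeroCoefs L d).card = 0 then {d}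
  else if (zeroCoefs L d).card = 1 then findOne L d
  else (zeroCoefs L d)ᶜ.image (bump d) ∪
    (zeroCoefs L d).biUnion (fun s => findOne L (bump d s))

/-- The minimal `x ∈ ℕ^n` for which `M + Diag(x)` has non-negative determinant, where
`M = Diag(d) - L`, found by searching the box `[0, max(0, -det M)]^n`.  It is called only at `d`
for which the proper principal minors of `M` are positive. -/
def minCompletions {n : ℕ} (L : Matrix (Fin n) (Fin n) ℕ) (d : Fin n → ℕ) :
    Finset (Fin n → ℕ) :=
  minimals ((Fintype.piFinset
    (fun _ : Fin n => Finset.range ((-(diagSub L d).det).toNat + 1))).filter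
      (fun x => 0 ≤ (diagSub L (d + x)).det))

/-- The recursive step: from `A s`, the output for the matrix with the `s`-th row and column
deleted, for every `s`, to the output for `L`.  Every vector of `A s` gets a new `s`-th entry `1`,
one forms the componentwise maximum `d` of a choice of one such vector for every `s`, and runs
`Find` and the search for minimal completions on `d`; of all the vectors found, the minimal ones
are kept. -/
def stepMinD {n : ℕ} (L : Matrix (Fin (n + 1)) (Fin (n + 1)) ℕ)
    (A : Fin (n + 1) → Finset (Fin n → ℕ)) : Finset (Fin (n + 1) → ℕ) :=
  let As : Fin (n + 1) → Finset (Fin (n + 1) → ℕ) := fun s =>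
    (A s).image (fun d => s.insertNth (α := fun _ => ℕ) 1 d)
  let ds : Finset (Fin (n + 1) → ℕ) :=
    (Fintype.piFinset As).image (fun δ i => Finset.univ.sup (fun s => δ s i))
  minimals ((ds.biUnion (find L)).biUnion
    (fun d => (minCompletions L d).image (fun x => d + x)))

/-- The algorithm computing `min D_{≥0}(L)`, by recursion on the size, with an explicit formula
for matrices of size two. -/
def algMinD : (n : ℕ) → Matrix (Fin n) (Fin n) ℕ → Finset (Fin n → ℕ)
  | 0, _ => {fun _ => 1}
  | 1, _ => {fun _ => 1}
  | 2, L =>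
      minimals ((Finset.Icc 1 (max 1 (L 0 1 * L 1 0))).image
        (fun d => ![d, max 1 ((L 0 1 * L 1 0) ⌈/⌉ d)]))
  | n + 3, L =>
      stepMinD L (fun s => algMinD (n + 2) (L.submatrix s.succAbove s.succAbove))

/-! ### The algorithm computing the `d`-arithmetical structures -/

/-- The output is either a finite list of vectors or the message that there are infinitely many
arithmetical structures. -/
inductive Output (n : ℕ) : Type
  | vectors (D : Finset (Fin n → ℕ)) : Output n
  | infinitelyMany : Output n

/-- The algorithm AA. -/
def algAA {n : ℕ} (L : Matrix (Fin n) (Fin n) ℕ) : Output n :=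
  if ¬ IsReducible L then
    Output.vectors ((algMinD n L).filter (fun d => (diagSub L d).det = 0))
  else if HasZeroRow L then
    Output.vectors ∅
  else
    Output.infinitelyMany

end ArithStruct

/-!
Everything rests on the multilinear expansion of the principal minors of `M + Diag(c)` in the
entries of `c`, whose coefficients are the principal minors of `M`.  Once the proper principal
minors are non-negative, the minors are therefore monotone in the diagonal, and strictly so where
the relevant coefficients are positive.

*The procedure `Min`.*  If the deletions of one row and column from `Diag(d) - L` are almost
non-singular, the only proper principal minors that can vanish are those with one index deleted, and
they are the coefficients that `Find` tests.  Increasing the entry `t` makes all of them positive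
except the one with `t` deleted, which does not depend on that entry.  So `Find` gives vectors
above `d` with positive proper principal minors, including one below any given such vector, and the
search for completions then makes the determinant non-negative with the smallest possible increase.

*Irreducible matrices.*  If `(Diag(d) - L) r = 0` with `r` positive, scaling the columns by `r`
gives a matrix with non-positive off-diagonal entries and zero row sums.  Its principal minors are
non-negative, and by the maximum principle a proper one that vanishes yields a set of indices closed
under `L`, so that `L` is reducible.  Conversely, if the proper principal minors of `Diag(d) - L`
are positive and its determinant is zero, a kernel vector `v` with a positive entry is positive:
otherwise let `P` be the set of its positive entries; scaling the columns by `v` gives a matrix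
whose row sums over `P` are non-positive on `P`, so the proper minor at `P` would be non-positive.
-/

namespace ArithStruct

open Finset Matrix

section Minor

variable {ι R : Type*} [DecidableEq ι] [CommRing R]

/-- The principal minor of `M` with rows and columns in `I`, over an arbitrary commutative ring and
index type; `principalMinor` is the case of integer matrices indexed by `Fin n`. -/
def minor (M : Matrix ι ι R) (I : Finset ι) : R :=
  (M.submatrix (fun i : {x // x ∈ I} => i.val) (fun i : {x // x ∈ I} => i.val)).det

lemma minor_congr {M N : Matrix ι ι R} {I : Finset ι}
    (h : ∀ i ∈ I, ∀ j ∈ I, M i j = N i j) : minor M I = minor N I :=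
  congrArg Matrix.det (Matrix.ext fun i j => h i i.2 j j.2)

lemma minor_submatrix {κ : Type*} [DecidableEq κ] (f : κ ↪ ι) (M : Matrix ι ι R) (J : Finset κ) :
    minor (M.submatrix f f) J = minor M (J.map f) :=
  det_submatrix_equiv_self (J.equivMap f)
    (M.submatrix (fun i : {x // x ∈ J.map f} => i.val) (fun i : {x // x ∈ J.map f} => i.val))

lemma minor_diagonal (c : ι → R) (I : Finset ι) : minor (diagonal c) I = ∏ i ∈ I, c i := by
  rw [minor, submatrix_diagonal _ _ Subtype.val_injective, det_diagonal]
  exact prod_coe_sort I c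

lemma minor_mul_diagonal [Fintype ι] (M : Matrix ι ι R) (c : ι → R) (I : Finset ι) :
    minor (M * diagonal c) I = minor M I * ∏ i ∈ I, c i := by
  rw [← prod_coe_sort, mul_comm, minor, minor, ← det_mul_row]
  congr 1
  ext i j
  simp [mul_comm]

lemma minor_univ [Fintype ι] (M : Matrix ι ι R) : minor M univ = M.det :=
  det_submatrix_equiv_self (Equiv.subtypeUnivEquiv mem_univ) M

lemma det_piecewise_diagonal [Fintype ι] (M : Matrix ι ι R) (c : ι → R) (J : Finset ι) :
    (of (J.piecewise M.row (diagonal c).row)).det = minor M J * ∏ i ∈ Jᶜ, c i := by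
  have hrows : of (J.piecewise M.row (diagonal c).row) =
      of fun i j => (if i ∈ Jᶜ then c i else 1) * of (J.piecewise M.row (row 1)) i j := by
    ext i j
    by_cases hi : i ∈ J <;> simp [hi, diagonal_apply, one_apply]
  rw [hrows, det_mul_column, det_piecewise_one_eq_submatrix_det, Fintype.prod_ite_mem, mul_comm]
  rfl

/-- The multilinear expansion of the determinant, applied after replacing the rows outside `I` by
those of the identity matrix. -/
theorem minor_add_diagonal [Finite ι] (M : Matrix ι ι R) (c : ι → R) (I : Finset ι) :
    minor (M + diagonal c) I = ∑ J ∈ I.powerset, minor M J * ∏ i ∈ I \ J, c i := by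
  cases nonempty_fintype ι
  let c' : ι → R := I.piecewise c 1
  have hI : of (I.piecewise (M + diagonal c).row (row 1)) =
      of (I.piecewise (M.row + (diagonal c').row) (diagonal c').row) := by
    ext i j
    by_cases hi : i ∈ I <;> simp [hi, c', diagonal_apply, one_apply, Pi.single_apply, eq_comm]
  calc minor (M + diagonal c) I
      = (of (I.piecewise (M + diagonal c).row (row 1))).det :=
        (det_piecewise_one_eq_submatrix_det _ I).symm
    _ = ∑ J ∈ I.powerset, (of (J.piecewise M.row (diagonal c').row)).det := by
        rw [hI]
        exact detRowAlternating.toMultilinearMap.map_piecewise_add M.row (diagonal c').row I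
    _ = ∑ J ∈ I.powerset, minor M J * ∏ i ∈ I \ J, c i := by
        refine sum_congr rfl fun J _ => ?_
        rw [det_piecewise_diagonal]
        congr 1
        calc ∏ i ∈ Jᶜ, c' i
            = ∏ i ∈ I \ J, c' i := by
              refine (prod_subset (by grind [mem_compl]) fun i hi hiIJ => ?_).symm
              exact I.piecewise_eq_of_notMem c 1 (by grind [mem_compl])
          _ = ∏ i ∈ I \ J, c i :=
              prod_congr rfl fun i hi => I.piecewise_eq_of_mem c 1 (mem_sdiff.1 hi).1

lemma minor_eq_zero_of_sum_eq_zero [IsDomain R] {M : Matrix ι ι R} {I : Finset ι}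
    (hI : I.Nonempty) (hsum : ∀ i ∈ I, ∑ j ∈ I, M i j = 0) : minor M I = 0 := by
  refine exists_mulVec_eq_zero_iff.1 ⟨1, fun h => ?_, ?_⟩
  · obtain ⟨i, hi⟩ := hI
    exact one_ne_zero (congrFun h ⟨i, hi⟩)
  · ext i
    rw [mulVec, dotProduct_one]
    exact (sum_coe_sort I (M i)).trans (hsum i i.2)

/-- All proper principal minors of `M` are positive, as in the definition of an almost non-singular
`M`-matrix, over an arbitrary ordered ring and index type. -/
def HasPosProperMinors [Fintype ι] [Preorder R] (M : Matrix ι ι R) : Prop :=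
  ∀ I, I ≠ univ → 0 < minor M I

end Minor

section OrderedRing

variable {ι R : Type*} [Finite ι] [DecidableEq ι] [CommRing R] [PartialOrder R] [IsOrderedRing R]
  {M : Matrix ι ι R} {I : Finset ι} {c : ι → R}

lemma minor_add_mul_le_minor_add_diagonal (hM : ∀ J, J ⊂ I → 0 ≤ minor M J)
    (hc : ∀ i ∈ I, 0 ≤ c i) {s : ι} (hs : s ∈ I) :
    minor M I + c s * minor M (I.erase s) ≤ minor (M + diagonal c) I := by
  have hterm : ∀ J ∈ I.powerset \ {I, I.erase s}, 0 ≤ minor M J * ∏ i ∈ I \ J, c i := by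
    intro J hJ
    simp only [mem_sdiff, mem_powerset, mem_insert, mem_singleton, not_or] at hJ
    exact mul_nonneg (hM J (hJ.1.ssubset_of_ne hJ.2.1))
      (prod_nonneg fun i hi => hc i (mem_sdiff.1 hi).1)
  have hpair : ({I, I.erase s} : Finset (Finset ι)) ⊆ I.powerset := by
    simp [insert_subset_iff, erase_subset]
  calc minor M I + c s * minor M (I.erase s)
      = ∑ J ∈ {I, I.erase s}, minor M J * ∏ i ∈ I \ J, c i := by
        rw [sum_pair (erase_ssubset hs).ne', sdiff_self, sdiff_erase_self hs]
        simp [mul_comm]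
    _ ≤ ∑ J ∈ I.powerset, minor M J * ∏ i ∈ I \ J, c i := by
        rw [← sum_sdiff hpair]
        exact le_add_of_nonneg_left (sum_nonneg hterm)
    _ = minor (M + diagonal c) I := (minor_add_diagonal M c I).symm

lemma minor_le_minor_add_diagonal (hM : ∀ J, J ⊂ I → 0 ≤ minor M J) (hc : ∀ i ∈ I, 0 ≤ c i) :
    minor M I ≤ minor (M + diagonal c) I := by
  rcases I.eq_empty_or_nonempty with rfl | ⟨s, hs⟩
  · simp [minor]
  · exact (le_add_of_nonneg_right (mul_nonneg (hc s hs) (hM _ (erase_ssubset hs)))).trans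
      (minor_add_mul_le_minor_add_diagonal hM hc hs)

end OrderedRing

section ZMatrix

variable {ι R : Type*} [DecidableEq ι] [CommRing R] [LinearOrder R] [IsStrictOrderedRing R]
  {M : Matrix ι ι R} {I : Finset ι}

lemma minor_nonneg_of_sum_nonneg [Finite ι] (hM : Pairwise fun i j => M i j ≤ 0)
    (hsum : ∀ i ∈ I, 0 ≤ ∑ j ∈ I, M i j) : 0 ≤ minor M I := by
  induction I using Finset.strongInduction generalizing M with
  | H I ih =>
    rcases I.eq_empty_or_nonempty with rfl | hI
    · simp [minor]
    let c : ι → R := fun i => ∑ j ∈ I, M i j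
    have hzero : ∀ i ∈ I, ∑ j ∈ I, (M - diagonal c) i j = 0 := fun i hi => by
      simp [diagonal_apply, hi, c]
    have hoff : Pairwise fun i j => (M - diagonal c) i j ≤ 0 := fun i j hij => by
      simpa [hij] using hM hij
    have hproper : ∀ J, J ⊂ I → 0 ≤ minor (M - diagonal c) J := fun J hJ => by
      refine ih J hJ hoff fun i hi => ?_
      have hrest : ∑ j ∈ I \ J, (M - diagonal c) i j ≤ 0 := sum_nonpos fun j hj =>
        hoff (ne_of_mem_of_not_mem hi (mem_sdiff.1 hj).2)
      have hsplit := hzero i (hJ.subset hi)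
      rw [← sum_sdiff hJ.subset] at hsplit
      linarith
    calc 0 = minor (M - diagonal c) I := (minor_eq_zero_of_sum_eq_zero hI hzero).symm
      _ ≤ minor (M - diagonal c + diagonal c) I := minor_le_minor_add_diagonal hproper hsum
      _ = minor M I := by rw [sub_add_cancel]

lemma minor_nonpos_of_sum_nonpos [Finite ι] (hI : I.Nonempty)
    (hM : ∀ J, J ⊂ I → 0 ≤ minor M J)
    (hsum : ∀ i ∈ I, ∑ j ∈ I, M i j ≤ 0) : minor M I ≤ 0 := by
  let c : ι → R := fun i => -∑ j ∈ I, M i j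
  have hzero : ∀ i ∈ I, ∑ j ∈ I, (M + diagonal c) i j = 0 := fun i hi => by
    simp [sum_add_distrib, diagonal_apply, hi, c]
  calc minor M I ≤ minor (M + diagonal c) I :=
        minor_le_minor_add_diagonal hM fun i hi => neg_nonneg.2 (hsum i hi)
    _ = 0 := minor_eq_zero_of_sum_eq_zero hI hzero

variable [Fintype ι]

lemma exists_pos_of_minor_eq_zero (h : minor M I = 0) :
    ∃ w : ι → R, (∀ i ∉ I, w i = 0) ∧ (∀ i ∈ I, (M *ᵥ w) i = 0) ∧ ∃ i, 0 < w i := by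
  obtain ⟨v, hv, hMv⟩ := exists_mulVec_eq_zero_iff.2 h
  let w : ι → R := fun i => if hi : i ∈ I then v ⟨i, hi⟩ else 0
  have hwI : ∀ i ∉ I, w i = 0 := fun i hi => dif_neg hi
  have hMw : ∀ i ∈ I, (M *ᵥ w) i = 0 := fun i hi => by
    have hsub : ∑ j ∈ I, M i j * w j = ∑ j, M i j * w j :=
      sum_subset (subset_univ I) fun j _ hj => by rw [hwI j hj, mul_zero]
    rw [mulVec, dotProduct, ← hsub, ← sum_coe_sort I]
    simpa [mulVec, dotProduct, w] using congrFun hMv ⟨i, hi⟩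
  obtain ⟨⟨i, hi⟩, hvi⟩ := Function.ne_iff.1 hv
  have hwi : w i ≠ 0 := by simpa [w, hi] using hvi
  rcases hwi.lt_or_gt with hneg | hpos
  · exact ⟨-w, fun j hj => by simp [hwI j hj], fun j hj => by simp [mulVec_neg, hMw j hj],
      i, neg_pos.2 hneg⟩
  · exact ⟨w, hwI, hMw, i, hpos⟩

/-- The maximum principle: `J` is the set where a kernel vector attains its maximum. -/
theorem exists_closed_subset_of_minor_eq_zero (hM : Pairwise fun i j => M i j ≤ 0)
    (hsum : ∀ i, 0 ≤ ∑ j, M i j) (h : minor M I = 0) :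
    ∃ J ⊆ I, J.Nonempty ∧ ∀ i ∈ J, ∀ j ∉ J, M i j = 0 := by
  obtain ⟨w, hwI, hMw, i₀, hi₀⟩ := exists_pos_of_minor_eq_zero h
  obtain ⟨k, hk⟩ := @Finite.exists_max _ _ _ ⟨i₀⟩ _ w
  have hkpos : 0 < w k := hi₀.trans_le (hk i₀)
  refine ⟨univ.filter fun i => w i = w k, fun i hi => ?_, ⟨k, by simp⟩, fun i hi j hj => ?_⟩
  · by_contra hiI
    exact hkpos.ne (hwI i hiI ▸ (mem_filter.1 hi).2)
  simp only [mem_filter_univ] at hi hj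
  have hiI : i ∈ I := by_contra fun hiI => hkpos.ne (hwI i hiI ▸ hi)
  have hterm : ∀ j ∈ univ, 0 ≤ M i j * (w j - w k) := fun j _ => by
    rcases eq_or_ne i j with rfl | hij
    · simp [hi]
    · exact mul_nonneg_of_nonpos_of_nonpos (hM hij) (sub_nonpos.2 (hk j))
  have hle : ∑ j, M i j * (w j - w k) ≤ 0 := by
    calc ∑ j, M i j * (w j - w k) = (M *ᵥ w) i - (∑ j, M i j) * w k := by
          simp only [mul_sub, sum_sub_distrib, sum_mul, mulVec, dotProduct]
      _ ≤ 0 := by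
          rw [hMw i hiI, zero_sub, neg_nonpos]
          exact mul_nonneg (hsum i) hkpos.le
  have hzero := (sum_eq_zero_iff_of_nonneg hterm).1 (hle.antisymm (sum_nonneg hterm)) j (mem_univ j)
  exact (mul_eq_zero.1 hzero).resolve_right (sub_ne_zero.2 hj)

lemma forall_pos_of_mulVec_nonpos (hM : Pairwise fun i j => M i j ≤ 0)
    (hpos : HasPosProperMinors M) {v : ι → R} (hv : ∀ i, (M *ᵥ v) i ≤ 0) (h : ∃ i, 0 < v i)
    (i : ι) : 0 < v i := by
  let P : Finset ι := univ.filter fun j => 0 < v j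
  have hprod : 0 < ∏ j ∈ P, v j := prod_pos fun j hj => (mem_filter.1 hj).2
  suffices hP : P = univ by
    have hi : i ∈ P := hP ▸ mem_univ i
    simpa [P] using hi
  by_contra hP
  have hproper : ∀ J, J ⊂ P → 0 ≤ minor (M * diagonal v) J := fun J hJ => by
    rw [minor_mul_diagonal]
    exact mul_nonneg (hpos J fun hJu => (hJu ▸ hJ).2 (subset_univ _)).le
      (prod_nonneg fun j hj => (mem_filter.1 (hJ.subset hj)).2.le)
  have hsum : ∀ i ∈ P, ∑ j ∈ P, (M * diagonal v) i j ≤ 0 := fun i hi => by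
    simp only [mul_diagonal]
    refine le_trans ?_ (hv i)
    rw [mulVec, dotProduct, ← sum_sdiff (subset_univ P)]
    refine le_add_of_nonneg_left (sum_nonneg fun j hj => ?_)
    have hjP : j ∉ P := (mem_sdiff.1 hj).2
    exact mul_nonneg_of_nonpos_of_nonpos (hM (ne_of_mem_of_not_mem hi hjP)) (by simpa [P] using hjP)
  have hnonpos : minor (M * diagonal v) P ≤ 0 :=
    minor_nonpos_of_sum_nonpos (by simpa [P, Finset.Nonempty] using h) hproper hsum
  rw [minor_mul_diagonal] at hnonpos
  exact hnonpos.not_gt (mul_pos (hpos P hP) hprod)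

lemma eq_zero_of_mulVec_eq_zero_of_apply_eq_zero (hM : Pairwise fun i j => M i j ≤ 0)
    (hpos : HasPosProperMinors M) {v : ι → R} (hv : M *ᵥ v = 0) {k : ι} (hk : v k = 0) : v = 0 := by
  have hle : ∀ w, M *ᵥ w = 0 → w k = 0 → ∀ i, w i ≤ 0 := fun w hw hwk i => by
    by_contra! hi
    exact (forall_pos_of_mulVec_nonpos hM hpos (fun j => (congrFun hw j).le) ⟨i, hi⟩ k).ne' hwk
  ext i
  refine (hle v hv hk i).antisymm (neg_nonpos.1 (hle (-v) ?_ ?_ i))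
  · rw [mulVec_neg, hv, neg_zero]
  · rw [Pi.neg_apply, hk, neg_zero]

theorem hasPosProperMinors_of_mulVec_nonneg (hM : Pairwise fun i j => M i j ≤ 0) {r : ι → R}
    (hr : ∀ i, 0 < r i) (hMr : ∀ i, 0 ≤ (M *ᵥ r) i)
    (hirr : ∀ J : Finset ι, J.Nonempty → J ≠ univ → ∃ i ∈ J, ∃ j ∉ J, M i j ≠ 0) :
    HasPosProperMinors M := by
  intro I hI
  let N : Matrix ι ι R := M * diagonal r
  have hN : ∀ i j, N i j = M i j * r j := mul_diagonal r M
  have hoff : Pairwise fun i j => N i j ≤ 0 := fun i j hij =>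
    (hN i j).trans_le (mul_nonpos_of_nonpos_of_nonneg (hM hij) (hr j).le)
  have hsum : ∀ i, 0 ≤ ∑ j, N i j := fun i => by
    simpa only [hN, mulVec, dotProduct] using hMr i
  have hsumI : ∀ i ∈ I, 0 ≤ ∑ j ∈ I, N i j := fun i hi => by
    have hrest : ∑ j ∈ univ \ I, N i j ≤ 0 := sum_nonpos fun j hj =>
      hoff (ne_of_mem_of_not_mem hi (mem_sdiff.1 hj).2)
    have hsplit := hsum i
    rw [← sum_sdiff (subset_univ I)] at hsplit
    linarith
  have hne : minor N I ≠ 0 := fun h0 => by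
    obtain ⟨J, hJI, hJ, hclosed⟩ := exists_closed_subset_of_minor_eq_zero hoff hsum h0
    obtain ⟨i, hi, j, hj, hij⟩ := hirr J hJ fun hJu => hI (univ_subset_iff.1 (hJu ▸ hJI))
    exact mul_ne_zero hij (hr j).ne' (hN i j ▸ hclosed i hi j hj)
  have hpos : 0 < minor N I := (minor_nonneg_of_sum_nonneg hoff hsumI).lt_of_ne' hne
  rw [minor_mul_diagonal] at hpos
  exact pos_of_mul_pos_left hpos (prod_nonneg fun i _ => (hr i).le)

end ZMatrix

section DiagSub

variable {n : ℕ} {L : Matrix (Fin n) (Fin n) ℕ} {d d' : Fin n → ℕ} {I : Finset (Fin n)}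
  {s : Fin n}

lemma diagSub_apply (i j : Fin n) :
    diagSub L d i j = (if i = j then (d i : ℤ) else 0) - L i j := by
  simp [diagSub, diagonal_apply]

lemma diagSub_mulVec_apply (v : Fin n → ℤ) (i : Fin n) :
    (diagSub L d *ᵥ v) i = d i * v i - ∑ j, (L i j : ℤ) * v j := by
  rw [diagSub, sub_mulVec, Pi.sub_apply, mulVec_diagonal]
  rfl

lemma diagSub_eq_add_diagonal (L : Matrix (Fin n) (Fin n) ℕ) (d d' : Fin n → ℕ) :
    diagSub L d' = diagSub L d + diagonal fun i => (d' i : ℤ) - d i := by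
  ext i j
  simp only [diagSub_apply, Matrix.add_apply, diagonal_apply]
  split_ifs <;> ring

lemma isZMatrix_diagSub (L : Matrix (Fin n) (Fin n) ℕ) (d : Fin n → ℕ) :
    IsZMatrix (diagSub L d) := fun i j hij => by
  simp [diagSub_apply, hij]

lemma minor_diagSub_congr (h : ∀ i ∈ I, d i = d' i) :
    minor (diagSub L d) I = minor (diagSub L d') I :=
  minor_congr fun i hi j _ => by simp only [diagSub_apply, h i hi]

lemma minor_diagSub_mono (hd : ∀ J, J ⊂ I → 0 ≤ minor (diagSub L d) J) (h : d ≤ d') :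
    minor (diagSub L d) I ≤ minor (diagSub L d') I := by
  rw [diagSub_eq_add_diagonal L d d']
  exact minor_le_minor_add_diagonal hd fun i _ => sub_nonneg.2 (Int.ofNat_le.2 (h i))

lemma minor_diagSub_add_mul_le (hd : ∀ J, J ⊂ I → 0 ≤ minor (diagSub L d) J) (h : d ≤ d')
    (hs : s ∈ I) :
    minor (diagSub L d) I + ((d' s : ℤ) - d s) * minor (diagSub L d) (I.erase s) ≤
      minor (diagSub L d') I := by
  rw [diagSub_eq_add_diagonal L d d']
  exact minor_add_mul_le_minor_add_diagonal hd (fun i _ => sub_nonneg.2 (Int.ofNat_le.2 (h i))) hs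

lemma minor_diagSub_lt (hd : ∀ J, J ⊂ I → 0 ≤ minor (diagSub L d) J) (h : d ≤ d')
    (hs : s ∈ I) (hlt : d s < d' s) (hpos : 0 < minor (diagSub L d) (I.erase s)) :
    minor (diagSub L d) I < minor (diagSub L d') I :=
  (lt_add_of_pos_right _ (mul_pos (sub_pos.2 (Int.ofNat_lt.2 hlt)) hpos)).trans_le
    (minor_diagSub_add_mul_le hd h hs)

lemma mem_dGeZero_iff : d ∈ dGeZero L ↔
    (∀ i, 0 < d i) ∧ HasPosProperMinors (diagSub L d) ∧ 0 ≤ (diagSub L d).det := by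
  refine and_congr_right fun _ => ⟨fun h => ⟨h.2, ?_⟩, fun h => ⟨⟨isZMatrix_diagSub L d, ?_⟩, h.1⟩⟩
  · exact minor_univ (diagSub L d) ▸ h.1.2 univ
  · intro I
    rcases eq_or_ne I univ with rfl | hI
    · exact h.2.trans_eq (minor_univ (diagSub L d)).symm
    · exact (h.1 I hI).le

lemma HasPosProperMinors.diagSub_mono (hd : HasPosProperMinors (diagSub L d)) (h : d ≤ d') :
    HasPosProperMinors (diagSub L d') := fun I hI =>
  (hd I hI).trans_le <| minor_diagSub_mono (fun J hJ => (hd J (hJ.trans_le le_top).ne).le) h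

lemma det_diagSub_mono (hd : HasPosProperMinors (diagSub L d)) (h : d ≤ d') :
    (diagSub L d).det ≤ (diagSub L d').det := by
  simpa only [minor_univ] using minor_diagSub_mono (I := univ) (fun J hJ => (hd J hJ.ne).le) h

lemma det_diagSub_lt (hd : HasPosProperMinors (diagSub L d)) (h : d < d') :
    (diagSub L d).det < (diagSub L d').det := by
  obtain ⟨hle, s, hs⟩ := Pi.lt_def.1 h
  simpa only [minor_univ] using minor_diagSub_lt (I := univ) (fun J hJ => (hd J hJ.ne).le) hle
    (mem_univ s) hs (hd _ (erase_ssubset (mem_univ s)).ne)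

lemma isUpperSet_dGeZero (L : Matrix (Fin n) (Fin n) ℕ) : IsUpperSet (dGeZero L) := by
  intro d d' h hd
  rw [mem_dGeZero_iff] at hd ⊢
  exact ⟨fun i => (hd.1 i).trans_le (h i), hd.2.1.diagSub_mono h,
    hd.2.2.trans (det_diagSub_mono hd.2.1 h)⟩

lemma mem_minDGeZero_of_det_eq_zero (hd : d ∈ dGeZero L) (h0 : (diagSub L d).det = 0) :
    d ∈ minDGeZero L := by
  refine ⟨hd, fun e he hle => ?_⟩
  by_contra hlt
  have hepos := mem_dGeZero_iff.1 he
  exact (hepos.2.2.trans_lt (det_diagSub_lt hepos.2.1 (lt_of_le_not_ge hle hlt))).ne' h0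

end DiagSub

lemma coe_minimals {n : ℕ} {A : Finset (Fin n → ℕ)} {S : Set (Fin n → ℕ)} (hAS : ↑A ⊆ S)
    (hSA : IsCoinitialFor S ↑A) : (minimals A : Set (Fin n → ℕ)) = {x | Minimal (· ∈ S) x} := by
  ext x
  simp only [minimals, coe_filter, Set.mem_ofPred_eq]
  constructor
  · rintro ⟨hx, hmin⟩
    refine ⟨hAS hx, fun y hy hyx => ?_⟩
    obtain ⟨z, hz, hzy⟩ := hSA hy
    exact hmin z hz (hzy.trans hyx) ▸ hzy
  · intro hx
    obtain ⟨y, hy, hyx⟩ := hSA hx.1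
    have hyx' : y = x := hyx.antisymm (hx.2 (hAS hy) hyx)
    exact ⟨hyx' ▸ hy, fun z hz hzx => le_antisymm hzx (hx.2 (hAS hz) hzx)⟩

section Bump

variable {n : ℕ} {d d' : Fin n → ℕ} {s : Fin n}

lemma bump_self (d : Fin n → ℕ) (s : Fin n) : bump d s s = d s + 1 :=
  Function.update_self ..

lemma bump_of_ne (d : Fin n → ℕ) {i : Fin n} (h : i ≠ s) : bump d s i = d i :=
  Function.update_of_ne h ..

lemma le_bump (d : Fin n → ℕ) (s : Fin n) : d ≤ bump d s :=
  le_update_self_iff.2 (Nat.le_succ _)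

lemma bump_le (h : d ≤ d') (hs : d s < d' s) : bump d s ≤ d' :=
  update_le_iff.2 ⟨hs, fun i _ => h i⟩

lemma exists_bump_le (h : d < d') : ∃ s, bump d s ≤ d' := by
  obtain ⟨hle, s, hs⟩ := Pi.lt_def.1 h
  exact ⟨s, bump_le hle hs⟩

end Bump

/-- All the matrices obtained from `M` by deleting one row and the corresponding column satisfy the
condition on minors in the definition of an almost non-singular `M`-matrix; this is the state in
which the algorithm starts the procedure `find`. -/
structure HasAlmostNonsingDeletions {ι R : Type*} [Fintype ι] [DecidableEq ι] [CommRing R]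
    [Preorder R] (M : Matrix ι ι R) : Prop where
  nonneg : ∀ I, I ≠ univ → 0 ≤ minor M I
  pos : ∀ I s t, s ≠ t → s ∉ I → t ∉ I → 0 < minor M I

section Find

variable {n : ℕ} {L : Matrix (Fin n) (Fin n) ℕ} {d d' : Fin n → ℕ} {s t : Fin n}

lemma mem_zeroCoefs : s ∈ zeroCoefs L d ↔ minor (diagSub L d) (univ.erase s) = 0 :=
  mem_filter_univ s

lemma HasPosProperMinors.zeroCoefs_eq_empty (hd : HasPosProperMinors (diagSub L d)) :
    zeroCoefs L d = ∅ :=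
  eq_empty_of_forall_notMem fun s hs =>
    (hd _ (erase_ssubset (mem_univ s)).ne).ne' (mem_zeroCoefs.1 hs)

namespace HasAlmostNonsingDeletions

lemma diagSub_mono (hd : HasAlmostNonsingDeletions (diagSub L d)) (h : d ≤ d') :
    HasAlmostNonsingDeletions (diagSub L d') := by
  have hmono : ∀ I, minor (diagSub L d) I ≤ minor (diagSub L d') I := fun I =>
    minor_diagSub_mono (fun J hJ => hd.nonneg J (hJ.trans_le le_top).ne) h
  exact ⟨fun I hI => (hd.nonneg I hI).trans (hmono I),
    fun I s t hst hs ht => (hd.pos I s t hst hs ht).trans_le (hmono I)⟩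

lemma hasPosProperMinors (hd : HasAlmostNonsingDeletions (diagSub L d)) (h : zeroCoefs L d = ∅) :
    HasPosProperMinors (diagSub L d) := by
  intro I hI
  obtain ⟨s, hs⟩ : ∃ s, s ∉ I := by simpa [eq_univ_iff_forall] using hI
  rcases eq_or_ne I (univ.erase s) with rfl | hIs
  · exact (hd.nonneg _ hI).lt_of_ne' fun h0 => notMem_empty s (h ▸ mem_zeroCoefs.2 h0)
  · obtain ⟨t, hts, ht⟩ : ∃ t, t ≠ s ∧ t ∉ I := by
      contrapose! hIs
      ext t
      grind
    exact hd.pos I t s hts ht hs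

lemma zeroCoefs_anti (hd : HasAlmostNonsingDeletions (diagSub L d)) (h : d ≤ d') :
    zeroCoefs L d' ⊆ zeroCoefs L d := by
  intro s hs
  rw [mem_zeroCoefs] at hs ⊢
  have hne := (erase_ssubset (mem_univ s)).ne
  refine (hd.nonneg _ hne).antisymm' (hs ▸ minor_diagSub_mono (fun J hJ => ?_) h)
  exact hd.nonneg J (hJ.trans_le le_top).ne

lemma notMem_zeroCoefs (hd : HasAlmostNonsingDeletions (diagSub L d)) (h : d ≤ d') (hst : t ≠ s)
    (ht : d t < d' t) : s ∉ zeroCoefs L d' := fun hs => by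
  have hne := (erase_ssubset (mem_univ s)).ne
  have hlt : minor (diagSub L d) (univ.erase s) < minor (diagSub L d') (univ.erase s) := by
    refine minor_diagSub_lt (fun J hJ => hd.nonneg J (hJ.trans_le le_top).ne) h
      (mem_erase.2 ⟨hst, mem_univ t⟩) ht (hd.pos _ t s hst ?_ ?_) <;> simp
  exact ((hd.nonneg _ hne).trans_lt hlt).ne' (mem_zeroCoefs.1 hs)

lemma zeroCoefs_bump_of_notMem (hd : HasAlmostNonsingDeletions (diagSub L d))
    (ht : t ∉ zeroCoefs L d) : zeroCoefs L (bump d t) = ∅ := by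
  refine eq_empty_of_forall_notMem fun s hs => ?_
  have hs' : s ∈ zeroCoefs L d := hd.zeroCoefs_anti (le_bump d t) hs
  exact hd.notMem_zeroCoefs (le_bump d t) (ne_of_mem_of_not_mem hs' ht).symm
    (by rw [bump_self]; exact lt_add_one _) hs

lemma zeroCoefs_bump_of_mem (hd : HasAlmostNonsingDeletions (diagSub L d))
    (hs : s ∈ zeroCoefs L d) : zeroCoefs L (bump d s) = {s} := by
  refine eq_singleton_iff_unique_mem.2 ⟨?_, fun t ht => ?_⟩
  · rw [mem_zeroCoefs] at hs ⊢
    rw [← hs]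
    exact minor_diagSub_congr fun i hi => bump_of_ne d (ne_of_mem_erase hi)
  · by_contra hts
    exact hd.notMem_zeroCoefs (le_bump d s) (Ne.symm hts)
      (by rw [bump_self]; exact lt_add_one _) ht

lemma findOne_subset (hd : HasAlmostNonsingDeletions (diagSub L d)) :
    ↑(findOne L d) ⊆ {e | d ≤ e ∧ zeroCoefs L e = ∅} := by
  simp only [findOne, coe_image, Set.image_subset_iff]
  exact fun t ht => ⟨le_bump d t, hd.zeroCoefs_bump_of_notMem (mem_compl.1 ht)⟩

end HasAlmostNonsingDeletions

lemma isCoinitialFor_findOne (hs : zeroCoefs L d = {s}) :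
    IsCoinitialFor {e | d ≤ e ∧ zeroCoefs L e = ∅} ↑(findOne L d) := by
  rintro e ⟨hde, he⟩
  obtain ⟨t, hts, ht⟩ : ∃ t, t ≠ s ∧ d t < e t := by
    by_contra! hle
    have hse : s ∈ zeroCoefs L e := by
      rw [mem_zeroCoefs, ← mem_zeroCoefs.1 (hs ▸ mem_singleton_self s)]
      exact minor_diagSub_congr fun i hi => (hle i (ne_of_mem_erase hi)).antisymm (hde i)
    exact notMem_empty s (he ▸ hse)
  refine ⟨bump d t, mem_image_of_mem _ ?_, bump_le hde ht⟩
  rwa [hs, mem_compl, mem_singleton]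

namespace HasAlmostNonsingDeletions

lemma find_subset (hd : HasAlmostNonsingDeletions (diagSub L d)) :
    ↑(find L d) ⊆ {e | d ≤ e ∧ zeroCoefs L e = ∅} := by
  unfold find
  split_ifs with h0 h1
  · simpa using card_eq_zero.1 h0
  · exact hd.findOne_subset
  · rw [coe_union, coe_biUnion]
    refine Set.union_subset hd.findOne_subset (Set.iUnion₂_subset fun s _ e he => ?_)
    obtain ⟨hse, he0⟩ := (hd.diagSub_mono (le_bump d s)).findOne_subset he
    exact ⟨(le_bump d s).trans hse, he0⟩

lemma isCoinitialFor_find (hd : HasAlmostNonsingDeletions (diagSub L d)) :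
    IsCoinitialFor {e | d ≤ e ∧ zeroCoefs L e = ∅} ↑(find L d) := by
  unfold find
  split_ifs with h0 h1
  · exact fun e he => ⟨d, mem_coe.2 (mem_singleton_self d), he.1⟩
  · obtain ⟨s, hs⟩ := card_eq_one.1 h1
    exact isCoinitialFor_findOne hs
  · rintro e ⟨hde, he⟩
    obtain ⟨s, hse⟩ := exists_bump_le (hde.lt_of_ne fun h => h0 (h ▸ card_eq_zero.2 he))
    by_cases hs : s ∈ zeroCoefs L d
    · obtain ⟨f, hf, hfe⟩ := isCoinitialFor_findOne (hd.zeroCoefs_bump_of_mem hs) ⟨hse, he⟩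
      exact ⟨f, mem_union_right _ (mem_biUnion.2 ⟨s, hs, hf⟩), hfe⟩
    · exact ⟨_, mem_union_left _ (mem_image_of_mem _ (mem_compl.2 hs)), hse⟩

end HasAlmostNonsingDeletions

end Find

section Completion

variable {n : ℕ} {L : Matrix (Fin n) (Fin n) ℕ} {d : Fin n → ℕ}

/-- Decreasing the entry `x i` of a minimal completion by one makes the determinant negative, and
by `minor_diagSub_add_mul_le` it exceeds `det (Diag(d) - L)` by at least `x i - 1`. -/
lemma apply_le_of_minimal_det_nonneg (hd : HasPosProperMinors (diagSub L d)) {x : Fin n → ℕ}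
    (hx : Minimal (fun x => 0 ≤ (diagSub L (d + x)).det) x) (i : Fin n) :
    x i ≤ (-(diagSub L d).det).toNat := by
  rcases (x i).eq_zero_or_pos with h0 | hpos
  · omega
  let y := Function.update x i (x i - 1)
  have hy : (diagSub L (d + y)).det < 0 := by
    refine not_le.1 (hx.not_prop_of_lt (update_lt_self_iff.2 ?_))
    omega
  have hle : (diagSub L d).det + (x i - 1 : ℕ) * minor (diagSub L d) (univ.erase i) ≤
      (diagSub L (d + y)).det := by
    simpa [minor_univ, y] using minor_diagSub_add_mul_le (I := univ) (fun J hJ => (hd J hJ.ne).le)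
      (le_self_add (a := d) (b := y)) (mem_univ i)
  have hmul : ((x i - 1 : ℕ) : ℤ) ≤ (x i - 1 : ℕ) * minor (diagSub L d) (univ.erase i) :=
    le_mul_of_one_le_right (Int.natCast_nonneg _) (hd _ (erase_ssubset (mem_univ i)).ne)
  omega

lemma coe_minCompletions (hd : HasPosProperMinors (diagSub L d)) :
    (minCompletions L d : Set (Fin n → ℕ)) =
      {x | Minimal (· ∈ {x | 0 ≤ (diagSub L (d + x)).det}) x} := by
  refine coe_minimals (fun x hx => (mem_filter.1 hx).2) fun x hx => ?_
  obtain ⟨y, hyx, hy⟩ :=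
    exists_minimal_le_of_wellFoundedLT (fun x => 0 ≤ (diagSub L (d + x)).det) x hx
  refine ⟨y, mem_filter.2 ⟨Fintype.mem_piFinset.2 fun i => mem_range_succ_iff.2 ?_, hy.1⟩, hyx⟩
  exact apply_le_of_minimal_det_nonneg hd hy i

lemma add_mem_dGeZero_of_mem_minCompletions (hd : HasPosProperMinors (diagSub L d))
    (hpos : ∀ i, 0 < d i) {x : Fin n → ℕ} (hx : x ∈ minCompletions L d) : d + x ∈ dGeZero L := by
  rw [← mem_coe, coe_minCompletions hd] at hx
  exact mem_dGeZero_iff.2 ⟨fun i => (hpos i).trans_le (le_self_add (a := d) i),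
    hd.diagSub_mono le_self_add, hx.1⟩

lemma exists_mem_minCompletions_add_le (hd : HasPosProperMinors (diagSub L d)) {e : Fin n → ℕ}
    (hde : d ≤ e) (he : 0 ≤ (diagSub L e).det) : ∃ x ∈ minCompletions L d, d + x ≤ e := by
  obtain ⟨x, hxe, hx⟩ := exists_minimal_le_of_wellFoundedLT
    (· ∈ {x | 0 ≤ (diagSub L (d + x)).det}) (e - d) (by
      rwa [Set.mem_ofPred_eq, add_tsub_cancel_of_le hde])
  refine ⟨x, ?_, (add_le_add_right hxe d).trans_eq (add_tsub_cancel_of_le hde)⟩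
  rw [← mem_coe, coe_minCompletions hd]
  exact hx

end Completion

section Step

variable {n : ℕ} {L : Matrix (Fin (n + 1)) (Fin (n + 1)) ℕ} {d : Fin (n + 1) → ℕ}
  {A : Fin (n + 1) → Finset (Fin n → ℕ)}

lemma exists_map_succAboveEmb_eq {s : Fin (n + 1)} {I : Finset (Fin (n + 1))} (hs : s ∉ I) :
    ∃ J : Finset (Fin n), J.map s.succAboveEmb = I := by
  have hI : I ⊆ univ.map s.succAboveEmb := fun i hi => by
    obtain ⟨j, rfl⟩ := Fin.exists_succAbove_eq (ne_of_mem_of_not_mem hi hs)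
    exact mem_map_of_mem s.succAboveEmb (mem_univ j)
  obtain ⟨J, -, rfl⟩ := subset_map_iff.1 hI
  exact ⟨J, rfl⟩

lemma minor_diagSub_removeNth (d : Fin (n + 1) → ℕ) (s : Fin (n + 1)) (J : Finset (Fin n)) :
    minor (diagSub (L.submatrix s.succAbove s.succAbove) (s.removeNth d)) J =
      minor (diagSub L d) (J.map s.succAboveEmb) := by
  rw [← minor_submatrix]
  congr 1
  ext i j
  simp [diagSub_apply, Fin.removeNth_apply]

lemma removeNth_mem_dGeZero (hd : d ∈ dGeZero L) (s : Fin (n + 1)) :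
    s.removeNth d ∈ dGeZero (L.submatrix s.succAbove s.succAbove) := by
  obtain ⟨hpos, hminor, -⟩ := mem_dGeZero_iff.1 hd
  have hpos' : ∀ J, 0 < minor (diagSub (L.submatrix s.succAbove s.succAbove) (s.removeNth d)) J :=
    fun J => by
      rw [minor_diagSub_removeNth]
      refine hminor _ (ne_of_mem_of_not_mem' (mem_univ s) ?_).symm
      simp [Fin.succAbove_ne]
  exact mem_dGeZero_iff.2 ⟨fun i => hpos _, fun J _ => hpos' J,
    (hpos' univ).le.trans_eq (minor_univ _)⟩

lemma hasAlmostNonsingDeletions_of_removeNth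
    (h : ∀ s : Fin (n + 1), s.removeNth d ∈ dGeZero (L.submatrix s.succAbove s.succAbove)) :
    HasAlmostNonsingDeletions (diagSub L d) where
  nonneg I hI := by
    obtain ⟨s, hs⟩ : ∃ s, s ∉ I := by simpa [eq_univ_iff_forall] using hI
    obtain ⟨J, rfl⟩ := exists_map_succAboveEmb_eq hs
    rw [← minor_diagSub_removeNth]
    exact (h s).2.1.2 J
  pos I s t hst hs ht := by
    obtain ⟨J, rfl⟩ := exists_map_succAboveEmb_eq hs
    rw [← minor_diagSub_removeNth]
    obtain ⟨i, rfl⟩ := Fin.exists_succAbove_eq hst.symm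
    refine (h s).2.2 J (ne_of_mem_of_not_mem' (mem_univ i) fun hi => ht ?_).symm
    exact mem_map_of_mem s.succAboveEmb hi

/-- The componentwise maxima formed in the recursive step `stepMinD`: one vector is chosen from
every `A s` and gets a new `s`-th entry `1`. -/
def maxima (A : Fin (n + 1) → Finset (Fin n → ℕ)) : Finset (Fin (n + 1) → ℕ) :=
  (Fintype.piFinset fun s => (A s).image (s.insertNth (α := fun _ => ℕ) 1)).image
    fun δ i => univ.sup fun s => δ s i

lemma stepMinD_eq_minimals (L : Matrix (Fin (n + 1)) (Fin (n + 1)) ℕ)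
    (A : Fin (n + 1) → Finset (Fin n → ℕ)) :
    stepMinD L A = minimals (((maxima A).biUnion (find L)).biUnion fun d =>
      (minCompletions L d).image fun x => d + x) := rfl

lemma maxima_subset (A : Fin (n + 1) → Finset (Fin n → ℕ)) :
    ↑(maxima A) ⊆ {d : Fin (n + 1) → ℕ | ∀ s, ∃ a ∈ A s, 1 ≤ d s ∧ a ≤ s.removeNth d} := by
  intro d hd s
  simp only [maxima, coe_image, Set.mem_image, mem_coe, Fintype.mem_piFinset, mem_image] at hd
  obtain ⟨δ, hδ, rfl⟩ := hd
  obtain ⟨a, ha, haδ⟩ := hδ s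
  have hle : s.insertNth (α := fun _ => ℕ) 1 a ≤ fun i => univ.sup (δ · i) := fun i =>
    haδ ▸ le_sup (f := fun s => δ s i) (mem_univ s)
  exact ⟨a, ha, Fin.insertNth_le_iff.1 hle⟩

lemma isCoinitialFor_maxima (A : Fin (n + 1) → Finset (Fin n → ℕ)) :
    IsCoinitialFor {d : Fin (n + 1) → ℕ | ∀ s, ∃ a ∈ A s, 1 ≤ d s ∧ a ≤ s.removeNth d}
      ↑(maxima A) := by
  intro d hd
  choose a ha h1 hle using hd
  refine ⟨_, mem_image_of_mem _ (Fintype.mem_piFinset.2 fun s => mem_image_of_mem _ (ha s)), ?_⟩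
  exact fun i => Finset.sup_le fun s _ => Fin.insertNth_le_iff.2 ⟨h1 s, hle s⟩ i

lemma pos_and_hasAlmostNonsingDeletions_of_mem_maxima
    (hA : ∀ s, (A s : Set (Fin n → ℕ)) = minDGeZero (L.submatrix s.succAbove s.succAbove))
    (hd : d ∈ maxima A) :
    (∀ i, 0 < d i) ∧ HasAlmostNonsingDeletions (diagSub L d) := by
  choose a ha hpos hle using maxima_subset A hd
  refine ⟨hpos, hasAlmostNonsingDeletions_of_removeNth fun s => ?_⟩
  have has : a s ∈ minDGeZero (L.submatrix s.succAbove s.succAbove) := hA s ▸ mem_coe.2 (ha s)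
  exact isUpperSet_dGeZero _ (hle s) has.1

lemma isCoinitialFor_dGeZero_maxima
    (hA : ∀ s, (A s : Set (Fin n → ℕ)) = minDGeZero (L.submatrix s.succAbove s.succAbove)) :
    IsCoinitialFor (dGeZero L) ↑(maxima A) := by
  intro d hd
  refine isCoinitialFor_maxima A fun s => ?_
  obtain ⟨a, hle, ha⟩ := exists_minimal_le_of_wellFoundedLT
    (· ∈ dGeZero (L.submatrix s.succAbove s.succAbove)) _ (removeNth_mem_dGeZero hd s)
  exact ⟨a, mem_coe.1 (hA s ▸ ha), hd.1 s, hle⟩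

theorem coe_stepMinD
    (hA : ∀ s, (A s : Set (Fin n → ℕ)) = minDGeZero (L.submatrix s.succAbove s.succAbove)) :
    (stepMinD L A : Set (Fin (n + 1) → ℕ)) = minDGeZero L := by
  rw [stepMinD_eq_minimals, minDGeZero]
  refine coe_minimals (fun y hy => ?_) fun f hf => ?_
  · simp only [mem_coe, mem_biUnion, mem_image] at hy
    obtain ⟨e, ⟨d, hdA, hed⟩, x, hx, rfl⟩ := hy
    obtain ⟨hpos, hd⟩ := pos_and_hasAlmostNonsingDeletions_of_mem_maxima hA hdA
    obtain ⟨hde, he⟩ := hd.find_subset hed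
    exact add_mem_dGeZero_of_mem_minCompletions ((hd.diagSub_mono hde).hasPosProperMinors he)
      (fun i => (hpos i).trans_le (hde i)) hx
  · obtain ⟨-, hfpos, hfdet⟩ := mem_dGeZero_iff.1 hf
    obtain ⟨d, hdA, hdf⟩ := isCoinitialFor_dGeZero_maxima hA hf
    obtain ⟨-, hd⟩ := pos_and_hasAlmostNonsingDeletions_of_mem_maxima hA hdA
    obtain ⟨e, hed, hef⟩ := hd.isCoinitialFor_find ⟨hdf, hfpos.zeroCoefs_eq_empty⟩
    obtain ⟨hde, he⟩ := hd.find_subset hed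
    obtain ⟨x, hx, hxf⟩ := exists_mem_minCompletions_add_le
      ((hd.diagSub_mono hde).hasPosProperMinors he) hef hfdet
    exact ⟨e + x, mem_biUnion.2 ⟨e, mem_biUnion.2 ⟨d, hdA, hed⟩, mem_image_of_mem _ hx⟩, hxf⟩

end Step

lemma minor_diagSub_of_subsingleton {n : ℕ} {L : Matrix (Fin n) (Fin n) ℕ} (hL : ∀ i, L i i = 0)
    (d : Fin n → ℕ) {I : Finset (Fin n)} (hI : (I : Set (Fin n)).Subsingleton) :
    minor (diagSub L d) I = ∏ i ∈ I, (d i : ℤ) := by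
  rw [← minor_diagonal]
  refine minor_congr fun i hi j hj => ?_
  obtain rfl := hI hi hj
  simp [diagSub_apply, hL]

lemma minDGeZero_of_subsingleton {n : ℕ} [Subsingleton (Fin n)] {L : Matrix (Fin n) (Fin n) ℕ}
    (hL : ∀ i, L i i = 0) : minDGeZero L = {fun _ => 1} := by
  have hminor : ∀ {d : Fin n → ℕ}, (∀ i, 0 < d i) → ∀ I, 0 < minor (diagSub L d) I := fun hd I => by
    rw [minor_diagSub_of_subsingleton hL _ Set.subsingleton_of_subsingleton]
    exact prod_pos fun i _ => Nat.cast_pos.2 (hd i)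
  have hmem : ∀ {d}, (∀ i, 0 < d i) → d ∈ dGeZero L := fun hd =>
    mem_dGeZero_iff.2 ⟨hd, fun I _ => hminor hd I, minor_univ (diagSub L _) ▸ (hminor hd univ).le⟩
  have hleast : IsLeast (dGeZero L) fun _ => 1 := ⟨hmem fun _ => one_pos, fun d hd => hd.1⟩
  exact Set.ext fun d => hleast.minimal_iff

lemma mem_dGeZero_two_iff {L : Matrix (Fin 2) (Fin 2) ℕ} (hL : ∀ i, L i i = 0) {d : Fin 2 → ℕ} :
    d ∈ dGeZero L ↔ (∀ i, 0 < d i) ∧ L 0 1 * L 1 0 ≤ d 0 * d 1 := by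
  have hdet : (diagSub L d).det = (d 0 * d 1 : ℕ) - (L 0 1 * L 1 0 : ℕ) := by
    simp [det_fin_two, diagSub_apply, hL]
  rw [mem_dGeZero_iff, hdet, sub_nonneg, Nat.cast_le]
  refine and_congr_right fun hd => and_iff_right fun I hI => ?_
  have hcard : #I ≤ 1 := Nat.lt_succ_iff.1 ((card_lt_iff_ne_univ I).2 hI)
  rw [minor_diagSub_of_subsingleton hL d (card_le_one_iff_subsingleton.1 hcard)]
  exact prod_pos fun i _ => Nat.cast_pos.2 (hd i)

lemma coe_algMinD_two {L : Matrix (Fin 2) (Fin 2) ℕ} (hL : ∀ i, L i i = 0) :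
    (algMinD 2 L : Set (Fin 2 → ℕ)) = minDGeZero L := by
  refine coe_minimals (fun x hx => ?_) fun x hx => ?_
  · obtain ⟨d, hd, rfl⟩ := mem_image.1 hx
    have hd1 : 0 < d := (mem_Icc.1 hd).1
    refine (mem_dGeZero_two_iff hL).2 ⟨Fin.forall_fin_two.2 ⟨hd1, by simp⟩, ?_⟩
    calc L 0 1 * L 1 0 ≤ d * ((L 0 1 * L 1 0) ⌈/⌉ d) := le_smul_ceilDiv hd1
      _ ≤ d * max 1 ((L 0 1 * L 1 0) ⌈/⌉ d) := Nat.mul_le_mul_left d (le_max_right 1 _)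
  · obtain ⟨hpos, hle⟩ := (mem_dGeZero_two_iff hL).1 hx
    refine ⟨_, mem_image_of_mem _ (mem_Icc.2 ⟨le_min (hpos 0) (le_max_left 1 (L 0 1 * L 1 0)),
      min_le_right _ _⟩), Fin.forall_fin_two.2 ⟨min_le_left _ _, max_le (hpos 1) ?_⟩⟩
    refine (ceilDiv_le_iff_le_smul (lt_min (hpos 0) (lt_max_of_lt_left one_pos))).2 ?_
    rw [smul_eq_mul]
    rcases le_total (x 0) (max 1 (L 0 1 * L 1 0)) with h | h
    · rwa [min_eq_left h]
    · rw [min_eq_right h]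
      exact (le_max_right _ _).trans (Nat.le_mul_of_pos_right _ (hpos 1))

theorem coe_algMinD : ∀ {n : ℕ} {L : Matrix (Fin n) (Fin n) ℕ}, (∀ i, L i i = 0) →
    (algMinD n L : Set (Fin n → ℕ)) = minDGeZero L
  | 0, _, hL => by rw [algMinD, coe_singleton, minDGeZero_of_subsingleton hL]
  | 1, _, hL => by rw [algMinD, coe_singleton, minDGeZero_of_subsingleton hL]
  | 2, _, hL => coe_algMinD_two hL
  | _ + 3, _, hL => coe_stepMinD fun _ => coe_algMinD fun _ => hL _

section Reducible

variable {n : ℕ} {L : Matrix (Fin n) (Fin n) ℕ}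

lemma isReducible_iff : IsReducible L ↔
    ∃ J : Finset (Fin n), J.Nonempty ∧ J ≠ univ ∧ ∀ i ∈ J, ∀ j ∉ J, L i j = 0 := by
  constructor
  · rintro ⟨k, hk, σ, hσ⟩
    refine ⟨univ.filter fun i => k ≤ σ.symm i, ⟨σ k, by simp⟩, fun hJ => ?_, fun i hi j hj => ?_⟩
    · have h0 := (filter_eq_self.1 hJ) (σ ⟨0, k.pos⟩) (mem_univ _)
      rw [σ.symm_apply_apply] at h0
      exact hk.not_ge h0
    · simpa using hσ (σ.symm i) (σ.symm j) (by simpa using hi) (by simpa using hj)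
  · rintro ⟨J, hJ, hJu, hclosed⟩
    obtain ⟨i₀, hi₀⟩ : ∃ i, i ∉ J := by simpa [eq_univ_iff_forall] using hJu
    have hlt : #Jᶜ < n := (card_compl_lt_iff_nonempty J).2 hJ |>.trans_eq (Fintype.card_fin n)
    let k : Fin n := ⟨#Jᶜ, hlt⟩
    have hcard : Fintype.card {i // i < k} = Fintype.card {i // i ∈ Jᶜ} := by
      rw [Fintype.card_coe]
      exact Fintype.card_fin_lt_of_le hlt.le
    let e := Fintype.equivOfCardEq hcard
    refine ⟨k, card_pos.2 ⟨i₀, mem_compl.2 hi₀⟩, e.extendSubtype, ?_⟩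
    refine fun i j hi hj => hclosed _ ?_ _ ?_
    · simpa using e.extendSubtype_not_mem i (not_lt.2 hi)
    · simpa using e.extendSubtype_mem j hj

end Reducible

section Structures

variable {n : ℕ} {L : Matrix (Fin n) (Fin n) ℕ} {d r r' : Fin n → ℕ}

lemma diagSub_mulVec_eq_zero_iff :
    diagSub L d *ᵥ (fun i => (r i : ℤ)) = 0 ↔ ∀ i, d i * r i = ∑ j, L i j * r j := by
  simp only [funext_iff, diagSub_mulVec_apply, Pi.zero_apply, sub_eq_zero]
  exact forall_congr' fun i => by norm_cast

lemma structures_eq_empty (h : HasZeroRow L) : structures L = ∅ := by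
  obtain ⟨i, hi⟩ := h
  refine Set.eq_empty_of_forall_notMem fun p hp => (Nat.mul_pos (hp.1 i) (hp.2.1 i)).ne' ?_
  rw [diagSub_mulVec_eq_zero_iff.1 hp.2.2.1 i]
  simp [hi]

lemma dStructures_eq_empty (h : HasZeroRow L) : dStructures L = ∅ := by
  simp [dStructures, structures_eq_empty h]

/-- As `L i j = 0` for `i ∈ J` and `j ∉ J`, the entries of `r` in `J` can be scaled independently
of the others. -/
lemma exists_piecewise_mem_structures {J : Finset (Fin n)} (hJ : J ≠ univ)
    (hclosed : ∀ i ∈ J, ∀ j ∉ J, L i j = 0) (h0 : ¬ HasZeroRow L) {c : ℕ} (hc : 0 < c) :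
    ∃ d, (d, J.piecewise (fun _ => c) 1) ∈ structures L := by
  let r : Fin n → ℕ := J.piecewise (fun _ => c) 1
  have hr : ∀ i, 0 < r i := fun i => by by_cases hi : i ∈ J <;> simp [r, hi, hc]
  have hrow : ∀ i, ∃ j, 0 < L i j := by simpa [HasZeroRow, Nat.pos_iff_ne_zero] using h0
  let d : Fin n → ℕ := fun i => if i ∈ J then ∑ j, L i j else ∑ j, L i j * r j
  have hd : ∀ i, d i * r i = ∑ j, L i j * r j := fun i => by
    by_cases hi : i ∈ J
    · simp only [d, hi, if_true, sum_mul]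
      refine sum_congr rfl fun j _ => ?_
      by_cases hj : j ∈ J
      · simp [r, hi, hj]
      · rw [hclosed i hi j hj, zero_mul, zero_mul]
    · simp [d, r, hi]
  refine ⟨d, fun i => ?_, hr, diagSub_mulVec_eq_zero_iff.2 hd, ?_⟩
  · obtain ⟨j, hj⟩ := hrow i
    have hdr : 0 < d i * r i := hd i ▸
      sum_pos' (fun _ _ => Nat.zero_le _) ⟨j, mem_univ j, Nat.mul_pos hj (hr j)⟩
    exact Nat.pos_of_mul_pos_right hdr
  · obtain ⟨i₀, hi₀⟩ : ∃ i, i ∉ J := by simpa [eq_univ_iff_forall] using hJ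
    have hdvd : univ.gcd r ∣ r i₀ := gcd_dvd (mem_univ i₀)
    simpa [r, hi₀] using hdvd

theorem infinite_structures (hL : IsReducible L) (h0 : ¬ HasZeroRow L) :
    (structures L).Infinite := by
  obtain ⟨J, ⟨j₀, hj₀⟩, hJ, hclosed⟩ := isReducible_iff.1 hL
  choose d hd using fun c : ℕ => exists_piecewise_mem_structures hJ hclosed h0 c.succ_pos
  refine Set.infinite_of_injective_forall_mem (fun c c' h => ?_) hd
  simpa [hj₀] using congrFun (congrArg Prod.snd h) j₀

lemma det_eq_zero_of_mem_structures (h : (d, r) ∈ structures L) : (diagSub L d).det = 0 := by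
  obtain ⟨-, hr, heq, hgcd⟩ := h
  refine exists_mulVec_eq_zero_iff.1 ⟨_, fun hr0 => ?_, heq⟩
  have hempty : ∀ i, i ∉ (univ : Finset (Fin n)) := fun i _ =>
    (Nat.cast_pos.2 (hr i)).ne' (congrFun hr0 i)
  rw [eq_empty_of_forall_notMem hempty, gcd_empty] at hgcd
  exact zero_ne_one hgcd

lemma hasPosProperMinors_of_mem_structures (hL : ¬ IsReducible L) (h : (d, r) ∈ structures L) :
    HasPosProperMinors (diagSub L d) := by
  refine hasPosProperMinors_of_mulVec_nonneg (isZMatrix_diagSub L d)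
    (fun i => Nat.cast_pos.2 (h.2.1 i)) (fun i => (congrFun h.2.2.1 i).ge) fun J hJ hJu => ?_
  contrapose! hL
  refine isReducible_iff.2 ⟨J, hJ, hJu, fun i hi j hj => ?_⟩
  simpa [diagSub_apply, ne_of_mem_of_not_mem hi hj] using hL i hi j hj

lemma exists_mem_structures (hd : ∀ i, 0 < d i) (hpos : HasPosProperMinors (diagSub L d))
    (h0 : (diagSub L d).det = 0) : ∃ r, (d, r) ∈ structures L := by
  obtain ⟨v, -, hv, i₀, hi₀⟩ := exists_pos_of_minor_eq_zero ((minor_univ (diagSub L d)).trans h0)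
  have hvpos : ∀ i, 0 < v i := forall_pos_of_mulVec_nonpos (isZMatrix_diagSub L d) hpos
    (fun i => (hv i (mem_univ i)).le) ⟨i₀, hi₀⟩
  lift v to Fin n → ℕ using fun i => (hvpos i).le
  have hker : ∀ i, d i * v i = ∑ j, L i j * v j :=
    diagSub_mulVec_eq_zero_iff.1 (funext fun i => hv i (mem_univ i))
  obtain ⟨r, hvr, hr⟩ := extract_gcd v ⟨i₀, mem_univ i₀⟩
  have hprod : ∀ i, 0 < univ.gcd v * r i := fun i =>
    hvr i (mem_univ i) ▸ Nat.cast_pos.1 (hvpos i)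
  refine ⟨r, hd, fun i => Nat.pos_of_mul_pos_left (hprod i), ?_, hr⟩
  refine diagSub_mulVec_eq_zero_iff.2 fun i =>
    Nat.eq_of_mul_eq_mul_left (Nat.pos_of_mul_pos_right (hprod i₀)) ?_
  calc univ.gcd v * (d i * r i) = d i * v i := by rw [hvr i (mem_univ i)]; ring
    _ = ∑ j, L i j * v j := hker i
    _ = univ.gcd v * ∑ j, L i j * r j := by
      rw [mul_sum]
      exact sum_congr rfl fun j _ => by rw [hvr j (mem_univ j)]; ring

lemma eq_of_mem_structures (hpos : HasPosProperMinors (diagSub L d))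
    (h : (d, r) ∈ structures L) (h' : (d, r') ∈ structures L) : r = r' := by
  obtain ⟨-, -, hker, (hgcd : univ.gcd r = 1)⟩ := h
  obtain ⟨-, -, hker', (hgcd' : univ.gcd r' = 1)⟩ := h'
  ext i
  have hprop : ∀ j, r' i * r j = r i * r' j := fun j => by
    let w : Fin n → ℤ := (r' i : ℤ) • (fun j => (r j : ℤ)) - (r i : ℤ) • fun j => (r' j : ℤ)
    have hw : diagSub L d *ᵥ w = 0 := by
      simp only [w, mulVec_sub, mulVec_smul, hker, hker', smul_zero, sub_zero]
    have hwi : w i = 0 := by simp [w, mul_comm]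
    have hw0 : w = 0 :=
      eq_zero_of_mulVec_eq_zero_of_apply_eq_zero (isZMatrix_diagSub L d) hpos hw hwi
    have hwj : (r' i * r j : ℤ) - r i * r' j = 0 := by simpa [w] using congrFun hw0 j
    exact_mod_cast sub_eq_zero.1 hwj
  calc r i = univ.gcd fun j => r i * r' j := by
        rw [Finset.gcd_mul_left, hgcd', normalize_eq, mul_one]
    _ = univ.gcd fun j => r' i * r j := by simp only [hprop]
    _ = r' i := by rw [Finset.gcd_mul_left, hgcd, normalize_eq, mul_one]

theorem dStructures_eq (hL : ¬ IsReducible L) :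
    dStructures L = {d | d ∈ minDGeZero L ∧ (diagSub L d).det = 0} := by
  ext d
  constructor
  · rintro ⟨r, h⟩
    have h0 : (diagSub L d).det = 0 := det_eq_zero_of_mem_structures h
    have hpos := hasPosProperMinors_of_mem_structures hL h
    exact ⟨mem_minDGeZero_of_det_eq_zero (mem_dGeZero_iff.2 ⟨h.1, hpos, h0.ge⟩) h0, h0⟩
  · rintro ⟨⟨hd, -⟩, h0⟩
    obtain ⟨hdpos, hpos, -⟩ := mem_dGeZero_iff.1 hd
    exact exists_mem_structures hdpos hpos h0

theorem existsUnique_mem_structures (hL : ¬ IsReducible L) (hd : d ∈ dStructures L) :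
    ∃! r, (d, r) ∈ structures L := by
  obtain ⟨r, h⟩ := hd
  exact ⟨r, h, fun _ h' => eq_of_mem_structures (hasPosProperMinors_of_mem_structures hL h) h' h⟩

end Structures

section AlgAA

variable {n : ℕ} {L : Matrix (Fin n) (Fin n) ℕ}

lemma coe_filter_algMinD (hdiag : ∀ i, L i i = 0) (hL : ¬ IsReducible L) :
    ((algMinD n L).filter fun d => (diagSub L d).det = 0 : Set (Fin n → ℕ)) = dStructures L := by
  rw [dStructures_eq hL, ← coe_algMinD hdiag, coe_filter]
  rfl

lemma algAA_of_not_isReducible (hL : ¬ IsReducible L) :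
    algAA L = Output.vectors ((algMinD n L).filter fun d => (diagSub L d).det = 0) :=
  if_pos hL

lemma algAA_of_hasZeroRow (hdiag : ∀ i, L i i = 0) (h0 : HasZeroRow L) :
    algAA L = Output.vectors ∅ := by
  by_cases hL : IsReducible L
  · rw [algAA, if_neg (not_not.2 hL), if_pos h0]
  · rw [algAA_of_not_isReducible hL, Output.vectors.injEq, ← coe_eq_empty,
      coe_filter_algMinD hdiag hL, dStructures_eq_empty h0]

lemma algAA_of_isReducible (hL : IsReducible L) (h0 : ¬ HasZeroRow L) :
    algAA L = Output.infinitelyMany := by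
  rw [algAA, if_neg (not_not.2 hL), if_neg h0]

end AlgAA

end ArithStruct

open ArithStruct in
theorem mainTheorem2 {n : ℕ} (hn : 0 < n) (L : Matrix (Fin n) (Fin n) ℕ)
    (hL : ∀ i, L i i = 0) :
    -- the subroutine computes `min D_{≥0}(L)`
    (algMinD n L : Set (Fin n → ℕ)) = minDGeZero L ∧
    -- the irreducible case
    (¬ IsReducible L →
      ∃ D : Finset (Fin n → ℕ), algAA L = Output.vectors D ∧
        (D : Set (Fin n → ℕ)) = dStructures L ∧
        dStructures L = {d | d ∈ minDGeZero L ∧ (diagSub L d).det = 0} ∧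
        ∀ d ∈ D, ∃! r : Fin n → ℕ, (d, r) ∈ structures L) ∧
    -- a zero row
    (HasZeroRow L →
      algAA L = Output.vectors ∅ ∧ dStructures L = ∅ ∧ structures L = ∅) ∧
    -- otherwise
    (IsReducible L → ¬ HasZeroRow L →
      algAA L = Output.infinitelyMany ∧ (structures L).Infinite) := by
  refine ⟨coe_algMinD hL, fun hirr => ?_, fun h0 => ?_, fun hred h0 => ?_⟩
  · have hcoe := coe_filter_algMinD hL hirr
    refine ⟨_, algAA_of_not_isReducible hirr, hcoe, dStructures_eq hirr, fun d hd => ?_⟩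
    exact existsUnique_mem_structures hirr (hcoe ▸ Finset.mem_coe.2 hd)
  · exact ⟨algAA_of_hasZeroRow hL h0, dStructures_eq_empty h0, structures_eq_empty h0⟩
  · exact ⟨algAA_of_isReducible hred h0, infinite_structures hred h0⟩
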